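/- Let $\mathcal D\subseteq\mathbb C[z_1,z_2]$ be any class of polynomials (equations of plane curves) that contains every polynomial $f$ whose curve $f=0$ has an isolated singular point at the origin, i.e. $f$ and both its partial derivatives vanish at $0$ and have no other common zero near $0$; for instance $\mathcal D=\mathbb C[z_1,z_2]$. Call a polynomial $F\in\mathbb C[z_1,z_2,t]$, viewed as a map $(\mathbb C^2\times\mathbb C,\,0\times\mathbb C)\to(\mathbb C,0)$, *admissible* if $F$ vanishes on $0\times\mathbb C$, the set of points where all three partial derivatives of $F$ vanish is exactly $0\times\mathbb C$, and $F_t\in\mathcal D$ for all $t\in\mathbb C$, where $F_t(z)=F(z,t)$. Put $X_F=F^{-1}(0)\setminus(0\times\mathbb C)$ and $Y=0\times\mathbb C$. Recall that a pair $(X,Y)$ of disjoint submanifolds is (Whitney) $(a)$-regular at $y\in Y\cap\overline X$ if, for every sequence $x_i\in X$ converging to $y$ such that the tangent spaces $T_{x_i}X$ converge to a subspace $\tau$ (in the Grassmannian), one has $T_yY\subseteq\tau$; it is $(a)$-regular if this holds at every $y\in Y\cap\overline X$. **Proposition.** There is no invariant of plane curves whose constancy is equivalent to $(a)$-regularity.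 More precisely, for every set $S$: 1. there is no function $\alpha:\mathcal D\to S$ such that, for every admissible $F$, the value $\alpha(F_t)$ is constant in $t\in\mathbb C$ if and only if $(X_F,Y)$ is $(a)$-regular; 2. there is no function $\alpha:\mathcal D\to S$ such that, for every admissible $F$, the value $\alpha(F_t)$ is constant for $t$ near $0$ if and only if $(X_F,Y)$ is $(a)$-regular at the origin. No invariance property of $\alpha$ is assumed, so in particular no algebraic invariant of plane curves in $\mathbb C^2$ (of the polynomial, of the curve, or of its germ at $0$) has either property. -/

import Mathlib

open Filter Topology

namespace WhitneyA

section General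

variable {𝕜 E : Type*} [RCLike 𝕜] [NormedAddCommGroup E] [InnerProductSpace 𝕜 E]

/-- The tangent space at `x` of a submanifold `X` of `E` (real if `𝕜 = ℝ`, complex if `𝕜 = ℂ`):
the vectors that are velocities at `x` of curves lying in `X`. (For a submanifold these vectors
already form a linear subspace; `span` only records this.) -/
def tangentSpace (𝕜 : Type*) {E : Type*} [RCLike 𝕜] [NormedAddCommGroup E]
    [InnerProductSpace 𝕜 E] (X : Set E) (x : E) : Submodule 𝕜 E :=
  Submodule.span 𝕜
    {v : E | ∃ γ : 𝕜 → E, γ 0 = x ∧ (∀ᶠ s in 𝓝 (0 : 𝕜), γ s ∈ X) ∧ HasDerivAt γ v 0}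

/-- Convergence of linear subspaces in the Grassmannian of `E`: the orthogonal projections
converge. -/
def SubspaceTendsto [FiniteDimensional 𝕜 E] (T : ℕ → Submodule 𝕜 E) (τ : Submodule 𝕜 E) : Prop :=
  Tendsto (fun n => (T n).starProjection) atTop (𝓝 τ.starProjection)

/-- Whitney's condition (a) for the pair `(X, Y)` at the point `y`: whenever a sequence of points
of `X` converges to `y` and the tangent spaces of `X` along it converge to `τ`, the tangent space
of `Y` at `y` is contained in `τ`. -/
def IsARegularAt (𝕜 : Type*) {E : Type*} [RCLike 𝕜] [NormedAddCommGroup E]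
    [InnerProductSpace 𝕜 E] [FiniteDimensional 𝕜 E] (X Y : Set E) (y : E) : Prop :=
  ∀ (x : ℕ → E) (τ : Submodule 𝕜 E), (∀ n, x n ∈ X) → Tendsto x atTop (𝓝 y) →
    SubspaceTendsto (fun n => tangentSpace 𝕜 X (x n)) τ → tangentSpace 𝕜 Y y ≤ τ

/-- The pair `(X, Y)` is (a)-regular: condition (a) holds at every point of `Y ∩ closure X`. -/
def IsARegular (𝕜 : Type*) {E : Type*} [RCLike 𝕜] [NormedAddCommGroup E]
    [InnerProductSpace 𝕜 E] [FiniteDimensional 𝕜 E] (X Y : Set E) : Prop :=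
  ∀ y ∈ Y ∩ closure X, IsARegularAt 𝕜 X Y y

end General

/-- `ℂ² × ℂ`, with coordinates `0, 1` on `ℂ²` and coordinate `2`, the parameter `t`, on `ℂ`. -/
abbrev Space : Type := EuclideanSpace ℂ (Fin 3)

/-- The line `0 × ℂ`. -/
def paramAxis : Set Space := {p | p 0 = 0 ∧ p 1 = 0}

/-- The zero set `F⁻¹(0)`. -/
def zeroLocus (F : MvPolynomial (Fin 3) ℂ) : Set Space :=
  {p | MvPolynomial.eval (fun i => p i) F = 0}

/-- The singular set of the polynomial map `F`: the points where its differential vanishes. -/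
def singularSet (F : MvPolynomial (Fin 3) ℂ) : Set Space :=
  {p | ∀ i, MvPolynomial.eval (fun i => p i) (MvPolynomial.pderiv i F) = 0}

/-- The plane curve equation `F_t(z) = F(z, t)`. -/
noncomputable def slice (F : MvPolynomial (Fin 3) ℂ) (t : ℂ) : MvPolynomial (Fin 2) ℂ :=
  MvPolynomial.aeval ![MvPolynomial.X 0, MvPolynomial.X 1, MvPolynomial.C t] F

/-- `F : (ℂ² × ℂ, 0 × ℂ) → (ℂ, 0)` is a polynomial map with singular set `0 × ℂ`. -/
def IsFamily (F : MvPolynomial (Fin 3) ℂ) : Prop :=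
  paramAxis ⊆ zeroLocus F ∧ singularSet F = paramAxis

/-- The plane curve `f = 0` passes through the origin and has an isolated singular point there:
no other point near the origin is a common zero of `f` and its two partial derivatives. -/
def HasIsolatedSingularity (f : MvPolynomial (Fin 2) ℂ) : Prop :=
  MvPolynomial.eval 0 f = 0 ∧ (∀ i, MvPolynomial.eval 0 (MvPolynomial.pderiv i f) = 0) ∧
    ∀ᶠ z in 𝓝[≠] (0 : Fin 2 → ℂ), ¬ (MvPolynomial.eval z f = 0 ∧
      ∀ i, MvPolynomial.eval z (MvPolynomial.pderiv i f) = 0)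

end WhitneyA

/-!
Constancy of `α (F_t)` depends only on the set of slices of the family `F`, so it cannot change
under the substitution `t ↦ t²`, which is onto `ℂ` and maps neighbourhoods of `0` onto
neighbourhoods of `0`. Condition (a) on the other hand can be created by this substitution, because
it makes the velocity of the family in the direction of `t` vanish at `t = 0`.

Both families are of the form `y² = tᵏ x² + x³`, whose slices are the nodal cubics
`y² = c x² + x³`, degenerating to a cusp for `c = 0`.

* For `k = 1`, condition (a) fails at the origin: at the points `(s, 0, -s)` the tangent plane of
  the surface is the constant plane `dx + dt = 0`, which does not contain the `t`-axis
  (`tangentSpace_cubicFamily_one`, `not_isARegularAt_cubicFamily_one`).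
* For `k = 2`, the surface without the axis is parametrised by
  `(w, t) ↦ (w² - t², w (w² - t²), t)` with `w = y / x`. The derivatives of the parametrisation give
  explicit tangent vectors that converge to the direction of the `t`-axis at each of its points, so
  condition (a) holds everywhere (`isARegularAt_cubicFamily_two`).

An `α` as in the statement would thus be constant on the slices of the second family but not on
those of the first.
-/

namespace WhitneyA

open MvPolynomial

/-! ### The families of nodal cubics -/

/-- The plane cubic `y² - c x² - x³`: a node for `c ≠ 0`, a cusp for `c = 0`. -/
noncomputable def nodalCubic (c : ℂ) : MvPolynomial (Fin 2) ℂ :=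
  X 1 ^ 2 - C c * X 0 ^ 2 - X 0 ^ 3

/-- The family `y² - tᵏ x² - x³` of plane cubics, with slices `nodalCubic (t ^ k)`. -/
noncomputable def cubicFamily (k : ℕ) : MvPolynomial (Fin 3) ℂ :=
  X 1 ^ 2 - X 2 ^ k * X 0 ^ 2 - X 0 ^ 3

theorem slice_cubicFamily (k : ℕ) (t : ℂ) : slice (cubicFamily k) t = nodalCubic (t ^ k) := by
  simp [slice, cubicFamily, nodalCubic]

theorem hasIsolatedSingularity_nodalCubic (c : ℂ) : HasIsolatedSingularity (nodalCubic c) := by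
  refine ⟨by simp [nodalCubic], fun i => by fin_cases i <;> simp [nodalCubic, pderiv_X], ?_⟩
  filter_upwards [self_mem_nhdsWithin] with z hz
  rintro ⟨hf, hd⟩
  apply hz
  have h0 := hd 0
  have h1 := hd 1
  simp [nodalCubic, pderiv_X] at hf h0 h1
  have hx : z 0 = 0 := by
    by_contra hx
    rw [h1] at hf
    have e1 : c + z 0 = 0 := by
      refine (mul_eq_zero.mp (?_ : z 0 ^ 2 * (c + z 0) = 0)).resolve_left (pow_ne_zero _ hx)
      linear_combination -hf
    have e2 : 2 * c + 3 * z 0 = 0 := by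
      refine (mul_eq_zero.mp (?_ : z 0 * (2 * c + 3 * z 0) = 0)).resolve_left hx
      linear_combination -h0
    exact hx (by linear_combination e2 - 2 * e1)
  ext i
  fin_cases i
  · exact hx
  · exact h1

theorem mem_zeroLocus_cubicFamily {k : ℕ} {p : Space} :
    p ∈ zeroLocus (cubicFamily k) ↔ p 1 ^ 2 = p 0 ^ 2 * (p 2 ^ k + p 0) := by
  simp only [zeroLocus, cubicFamily, Set.mem_ofPred_eq, map_sub, map_mul, map_pow, eval_X]
  constructor <;> intro h <;> linear_combination h

theorem isFamily_cubicFamily {k : ℕ} (hk : k ≠ 0) : IsFamily (cubicFamily k) := by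
  refine ⟨fun p hp => ?_, Set.ext fun p => ⟨fun hp => ?_, fun hp i => ?_⟩⟩
  · rw [mem_zeroLocus_cubicFamily, hp.1, hp.2]
    ring
  · have h0 := hp 0
    have h1 := hp 1
    have h2 := hp 2
    simp [cubicFamily, pderiv_X, hk] at h0 h1 h2
    refine ⟨?_, h1⟩
    rcases h2 with h2 | h2
    · exact h2
    · simpa [h2.1, hk] using h0
  · have hx := hp.1
    have hy := hp.2
    fin_cases i <;> simp [cubicFamily, pderiv_X, hx, hy]

/-- On the surface minus the axis, the coordinate `x` does not vanish. -/
theorem coord_zero_ne_zero {k : ℕ} {p : Space} (hp : p ∈ zeroLocus (cubicFamily k) \ paramAxis) :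
    p 0 ≠ 0 := by
  intro h
  have h1 := mem_zeroLocus_cubicFamily.mp hp.1
  exact hp.2 ⟨h, by simpa [h] using h1⟩

theorem mem_surface {k : ℕ} {p : Space} (h : p 1 ^ 2 = p 0 ^ 2 * (p 2 ^ k + p 0)) (h0 : p 0 ≠ 0) :
    p ∈ zeroLocus (cubicFamily k) \ paramAxis :=
  ⟨mem_zeroLocus_cubicFamily.mpr h, fun hp => h0 hp.1⟩

/-! ### Tangent vectors -/

theorem hasDerivAt_coord {γ : ℂ → Space} {v : Space} {s : ℂ} (h : HasDerivAt γ v s) (i : Fin 3) :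
    HasDerivAt (fun r => γ r i) (v i) s :=
  (EuclideanSpace.proj i : Space →L[ℂ] ℂ).hasFDerivAt.comp_hasDerivAt s h

theorem hasDerivAt_vec {f g h : ℂ → ℂ} {a b c s : ℂ} (hf : HasDerivAt f a s)
    (hg : HasDerivAt g b s) (hh : HasDerivAt h c s) :
    HasDerivAt (fun r => (!₂[f r, g r, h r] : Space)) !₂[a, b, c] s := by
  rw [hasDerivAt_iff_hasFDerivAt, ← hasFDerivWithinAt_univ, hasFDerivWithinAt_euclidean]
  intro i
  rw [hasFDerivWithinAt_univ]
  fin_cases i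
  · exact hf.hasFDerivAt.congr_fderiv (by ext; simp)
  · exact hg.hasFDerivAt.congr_fderiv (by ext; simp)
  · exact hh.hasFDerivAt.congr_fderiv (by ext; simp)

theorem mem_tangentSpace_of_curve {X : Set Space} {p v : Space} {γ : ℂ → Space} (h0 : γ 0 = p)
    (hX : ∀ᶠ s in 𝓝 (0 : ℂ), γ s ∈ X) (hd : HasDerivAt γ v 0) : v ∈ tangentSpace ℂ X p :=
  Submodule.subset_span ⟨γ, h0, hX, hd⟩

/-- The direction of the `t`-axis is tangent to it. -/
theorem axis_mem_tangentSpace : (!₂[0, 0, 1] : Space) ∈ tangentSpace ℂ paramAxis 0 := by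
  refine mem_tangentSpace_of_curve (γ := fun r => !₂[0, 0, r]) ?_ ?_
    (hasDerivAt_vec (hasDerivAt_const _ _) (hasDerivAt_const _ _) (hasDerivAt_id _))
  · ext i
    fin_cases i <;> simp
  · exact Eventually.of_forall fun r => by simp [paramAxis]

theorem tangentSpace_paramAxis_le (y : Space) :
    tangentSpace ℂ paramAxis y ≤ Submodule.span ℂ {(!₂[0, 0, 1] : Space)} := by
  refine Submodule.span_le.mpr ?_
  rintro v ⟨γ, -, hX, hd⟩
  have h0 : v 0 = 0 := (hasDerivAt_coord hd 0).unique
    ((hasDerivAt_const (0 : ℂ) (0 : ℂ)).congr_of_eventuallyEq (hX.mono fun s hs => hs.1))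
  have h1 : v 1 = 0 := (hasDerivAt_coord hd 1).unique
    ((hasDerivAt_const (0 : ℂ) (0 : ℂ)).congr_of_eventuallyEq (hX.mono fun s hs => hs.2))
  refine Submodule.mem_span_singleton.mpr ⟨v 2, ?_⟩
  ext i
  fin_cases i <;> simp [h0, h1]

/-- Limits of vectors of `T n` lie in the limit of the subspaces `T n`. -/
theorem SubspaceTendsto.mem_of_tendsto {𝕜 E : Type*} [RCLike 𝕜] [NormedAddCommGroup E]
    [InnerProductSpace 𝕜 E] [FiniteDimensional 𝕜 E] {T : ℕ → Submodule 𝕜 E} {τ : Submodule 𝕜 E}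
    (hT : SubspaceTendsto T τ) {v : ℕ → E} {e : E} (hv : ∀ᶠ n in atTop, v n ∈ T n)
    (he : Tendsto v atTop (𝓝 e)) : e ∈ τ := by
  have hc : Continuous fun q : (E →L[𝕜] E) × E => q.1 q.2 := by fun_prop
  have hT' : Tendsto (fun n => (T n).starProjection) atTop (𝓝 τ.starProjection) := hT
  have h1 : Tendsto (fun n => (T n).starProjection (v n)) atTop (𝓝 (τ.starProjection e)) :=
    (hc.tendsto (τ.starProjection, e)).comp (hT'.prodMk_nhds he)
  have h2 : Tendsto v atTop (𝓝 (τ.starProjection e)) :=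
    h1.congr' (hv.mono fun n hn => Submodule.starProjection_eq_self_iff.mpr hn)
  exact Submodule.starProjection_eq_self_iff.mp (tendsto_nhds_unique h2 he)

theorem tendsto_vec {f g h : ℕ → ℂ} {a b c : ℂ} (hf : Tendsto f atTop (𝓝 a))
    (hg : Tendsto g atTop (𝓝 b)) (hh : Tendsto h atTop (𝓝 c)) :
    Tendsto (fun n => (!₂[f n, g n, h n] : Space)) atTop (𝓝 !₂[a, b, c]) := by
  refine (PiLp.continuous_toLp 2 _).continuousAt.tendsto.comp (tendsto_pi_nhds.mpr fun i => ?_)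
  fin_cases i
  exacts [hf, hg, hh]

theorem tendsto_zero_of_sq {u : ℕ → ℂ} (h : Tendsto (fun n => u n ^ 2) atTop (𝓝 0)) :
    Tendsto u atTop (𝓝 0) := by
  rw [tendsto_zero_iff_norm_tendsto_zero]
  simpa [norm_pow] using h.norm.sqrt

/-! ### The family `y² = t x² + x³` is not (a)-regular at the origin -/

/-- The plane `dx + dt = 0`. -/
noncomputable def antidiagonalPlane : Submodule ℂ Space :=
  LinearMap.ker ((EuclideanSpace.proj 0 + EuclideanSpace.proj 2 : Space →L[ℂ] ℂ) : Space →ₗ[ℂ] ℂ)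

theorem mem_antidiagonalPlane {v : Space} : v ∈ antidiagonalPlane ↔ v 0 + v 2 = 0 := by
  simp [antidiagonalPlane]

theorem tangentSpace_cubicFamily_one {s : ℂ} (hs : s ≠ 0) :
    tangentSpace ℂ (zeroLocus (cubicFamily 1) \ paramAxis) !₂[s, 0, -s] = antidiagonalPlane := by
  apply le_antisymm
  · refine Submodule.span_le.mpr ?_
    rintro v ⟨γ, h0, hX, hd⟩
    have d0 := hasDerivAt_coord hd 0
    have d1 := hasDerivAt_coord hd 1
    have d2 := hasDerivAt_coord hd 2
    have d := (d1.pow 2).sub ((d0.pow 2).mul (d2.add d0))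
    have h : HasDerivAt ((fun r => γ r 1) ^ 2 - (fun r => γ r 0) ^ 2 *
        ((fun r => γ r 2) + fun r => γ r 0)) 0 0 := by
      refine (hasDerivAt_const (0 : ℂ) (0 : ℂ)).congr_of_eventuallyEq (hX.mono fun r hr => ?_)
      have := mem_zeroLocus_cubicFamily.mp hr.1
      simp [this]
    have key := d.unique h
    simp [h0, hs] at key
    exact mem_antidiagonalPlane.mpr (by linear_combination key)
  · intro v hv
    rw [mem_antidiagonalPlane] at hv
    -- The plane is spanned by the velocity of the line `(s + r, 0, -s - r)` and that of a curve
    -- in the section `x = s` of the surface.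
    have a : (!₂[1, 0, -1] : Space) ∈
        tangentSpace ℂ (zeroLocus (cubicFamily 1) \ paramAxis) !₂[s, 0, -s] := by
      refine mem_tangentSpace_of_curve (γ := fun r => !₂[s + r, 0, -(s + r)]) (by simp) ?_
        (hasDerivAt_vec ((hasDerivAt_id _).const_add s) (hasDerivAt_const _ _)
          ((hasDerivAt_id _).const_add s).neg)
      have : ContinuousAt (fun r : ℂ => s + r) 0 := by fun_prop
      filter_upwards [this.eventually_ne (y := 0) (by simpa using hs)] with r hr
      exact mem_surface (by simp) (by simpa using hr)
    have b : (!₂[0, 1, 0] : Space) ∈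
        tangentSpace ℂ (zeroLocus (cubicFamily 1) \ paramAxis) !₂[s, 0, -s] := by
      refine mem_tangentSpace_of_curve (γ := fun r => !₂[s, r, -s + r ^ 2 / s ^ 2]) (by simp) ?_
        (hasDerivAt_vec (hasDerivAt_const _ _) (hasDerivAt_id _) ?_)
      · exact Eventually.of_forall fun r => mem_surface (by simp; field_simp) (by simpa using hs)
      · simpa using (((hasDerivAt_id (0 : ℂ)).pow 2).div_const (s ^ 2)).const_add (-s)
    have : v = v 0 • (!₂[1, 0, -1] : Space) + v 1 • (!₂[0, 1, 0] : Space) := by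
      ext i
      fin_cases i <;> simp
      linear_combination hv
    rw [this]
    exact Submodule.add_mem _ (Submodule.smul_mem _ _ a) (Submodule.smul_mem _ _ b)

/-- A sequence tending to the origin inside the curve `(s, 0, -s)`. -/
noncomputable def antidiagonalSeq (n : ℕ) : Space :=
  !₂[1 / ((n : ℂ) + 1), 0, -(1 / ((n : ℂ) + 1))]

theorem antidiagonalSeq_mem (n : ℕ) :
    antidiagonalSeq n ∈ zeroLocus (cubicFamily 1) \ paramAxis :=
  mem_surface (by simp [antidiagonalSeq])
    (by simpa [antidiagonalSeq] using Nat.cast_add_one_ne_zero (R := ℂ) n)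

theorem tendsto_antidiagonalSeq : Tendsto antidiagonalSeq atTop (𝓝 0) := by
  have h : Tendsto (fun n : ℕ => 1 / ((n : ℂ) + 1)) atTop (𝓝 0) :=
    tendsto_one_div_add_atTop_nhds_zero_nat
  have e : (0 : Space) = !₂[0, 0, -0] := by
    ext i
    fin_cases i <;> simp
  rw [e]
  exact tendsto_vec h tendsto_const_nhds h.neg

theorem not_isARegularAt_cubicFamily_one :
    ¬ IsARegularAt ℂ (zeroLocus (cubicFamily 1) \ paramAxis) paramAxis 0 := by
  intro h
  have h1 := h antidiagonalSeq antidiagonalPlane antidiagonalSeq_mem tendsto_antidiagonalSeq <| by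
    have (n : ℕ) : tangentSpace ℂ (zeroLocus (cubicFamily 1) \ paramAxis) (antidiagonalSeq n) =
        antidiagonalPlane :=
      tangentSpace_cubicFamily_one (one_div_ne_zero (Nat.cast_add_one_ne_zero (R := ℂ) n))
    simp only [SubspaceTendsto, this]
    exact tendsto_const_nhds
  have h2 := mem_antidiagonalPlane.mp (h1 axis_mem_tangentSpace)
  simp at h2

theorem not_isARegular_cubicFamily_one :
    ¬ IsARegular ℂ (zeroLocus (cubicFamily 1) \ paramAxis) paramAxis := fun h =>
  not_isARegularAt_cubicFamily_one <| h 0 ⟨by simp [paramAxis],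
    mem_closure_of_tendsto tendsto_antidiagonalSeq (Eventually.of_forall antidiagonalSeq_mem)⟩

/-! ### The family `y² = t² x² + x³` is (a)-regular -/

/-- Velocities of the curves `r ↦ Φ (w + a r, t + r)`, where
`Φ (w, t) = (w² - t², w (w² - t²), t)` parametrises the surface. -/
theorem param_mem_tangentSpace {p : Space} (hp : p ∈ zeroLocus (cubicFamily 2) \ paramAxis)
    {w : ℂ} (hw : p 1 = w * p 0) (a : ℂ) :
    (!₂[2 * w * a - 2 * p 2, a * (w ^ 2 - p 2 ^ 2) + w * (2 * w * a - 2 * p 2), 1] : Space) ∈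
      tangentSpace ℂ (zeroLocus (cubicFamily 2) \ paramAxis) p := by
  have h0 := coord_zero_ne_zero hp
  have h1 := mem_zeroLocus_cubicFamily.mp hp.1
  have hx : p 0 = w ^ 2 - p 2 ^ 2 := by
    refine mul_left_cancel₀ (pow_ne_zero 2 h0) ?_
    rw [hw] at h1
    linear_combination -h1
  have dw : HasDerivAt (fun r : ℂ => w + r * a) a 0 := by
    simpa using ((hasDerivAt_id (0 : ℂ)).mul_const a).const_add w
  have dt : HasDerivAt (fun r : ℂ => p 2 + r) 1 0 := (hasDerivAt_id _).const_add _
  have dx : HasDerivAt (fun r : ℂ => (w + r * a) ^ 2 - (p 2 + r) ^ 2) (2 * w * a - 2 * p 2) 0 := by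
    simpa [Pi.sub_def, Pi.pow_def] using (dw.pow 2).sub (dt.pow 2)
  have dy : HasDerivAt (fun r : ℂ => (w + r * a) * ((w + r * a) ^ 2 - (p 2 + r) ^ 2))
      (a * (w ^ 2 - p 2 ^ 2) + w * (2 * w * a - 2 * p 2)) 0 := by
    simpa [Pi.mul_def] using dw.mul dx
  refine mem_tangentSpace_of_curve ?_ ?_ (hasDerivAt_vec dx dy dt)
  · ext i
    fin_cases i <;> simp [hw, hx]
  · filter_upwards [dx.continuousAt.eventually_ne (y := 0) (by simpa [← hx] using h0)] with r hr
    exact mem_surface (by simp; ring) (by simpa using hr)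

theorem isARegularAt_cubicFamily_two {y : Space} (hy : y ∈ paramAxis) :
    IsARegularAt ℂ (zeroLocus (cubicFamily 2) \ paramAxis) paramAxis y := by
  intro x τ hx hlim hT
  have hc (i : Fin 3) : Tendsto (fun n => x n i) atTop (𝓝 (y i)) :=
    ((EuclideanSpace.proj i : Space →L[ℂ] ℂ).continuous.tendsto y).comp hlim
  have c0 : Tendsto (fun n => x n 0) atTop (𝓝 0) := hy.1 ▸ hc 0
  have c2 := hc 2
  set w : ℕ → ℂ := fun n => x n 1 / x n 0 with hw_def
  have hw (n : ℕ) : x n 1 = w n * x n 0 := (div_mul_cancel₀ _ (coord_zero_ne_zero (hx n))).symm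
  have hw2 (n : ℕ) : w n ^ 2 - x n 2 ^ 2 = x n 0 := by
    refine mul_left_cancel₀ (pow_ne_zero 2 (coord_zero_ne_zero (hx n))) ?_
    have h1 := mem_zeroLocus_cubicFamily.mp (hx n).1
    rw [hw n] at h1
    linear_combination h1
  have cw2 : Tendsto (fun n => w n ^ 2) atTop (𝓝 (y 2 ^ 2)) := by
    have := (c2.pow 2).add c0
    rw [add_zero] at this
    exact this.congr fun n => by rw [← hw2 n]; ring
  refine (tangentSpace_paramAxis_le y).trans
    ((Submodule.span_singleton_le_iff_mem _ _).mpr ?_)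
  rcases eq_or_ne (y 2) 0 with h | h
  · -- At the origin `w` tends to `0`, and the derivative in `t` of the parametrisation suffices.
    rw [h] at c2 cw2
    have cw : Tendsto w atTop (𝓝 0) := tendsto_zero_of_sq (by simpa using cw2)
    refine hT.mem_of_tendsto (Eventually.of_forall fun n => param_mem_tangentSpace (hx n) (hw n) 0)
      (tendsto_vec ?_ ?_ tendsto_const_nhds)
    · simpa using (c2.const_mul 2).neg
    · simpa using (cw.mul (c2.const_mul 2)).neg
  · -- Away from the origin `w` need not converge, but it is bounded away from `0`; with slope
    -- `t / w` the tangent vector is `(0, t (w² - t²) / w, 1)`.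
    have h2 : y 2 ^ 2 ≠ 0 := pow_ne_zero 2 h
    have hw0 : ∀ᶠ n in atTop, w n ≠ 0 :=
      (cw2.eventually_ne h2).mono fun n hn h => hn (by rw [h]; ring)
    have c : Tendsto (fun n => x n 2 * x n 0 / w n) atTop (𝓝 0) := by
      have q : Tendsto (fun n => (x n 2 * x n 0) ^ 2 / w n ^ 2) atTop (𝓝 0) := by
        simpa [Pi.div_def] using ((c2.mul c0).pow 2).div cw2 h2
      exact tendsto_zero_of_sq (by simpa only [div_pow] using q)
    refine hT.mem_of_tendsto (v := fun n => !₂[0, x n 2 * x n 0 / w n, 1]) ?_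
      (tendsto_vec tendsto_const_nhds c tendsto_const_nhds)
    filter_upwards [hw0] with n hn
    convert param_mem_tangentSpace (hx n) (hw n) (x n 2 / w n) using 2
    rw [hw2]
    have e : 2 * w n * (x n 2 / w n) - 2 * x n 2 = 0 := by
      field_simp
      ring
    rw [e, mul_zero, add_zero, div_mul_eq_mul_div]

/-! ### Squaring the parameter -/

/-- Squares of the points near `0` fill a neighbourhood of `0`. -/
theorem eventually_of_eventually_sq {P : ℂ → Prop} (h : ∀ᶠ t in 𝓝 (0 : ℂ), P (t ^ 2)) :
    ∀ᶠ t in 𝓝 (0 : ℂ), P t := by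
  obtain ⟨δ, hδ, H⟩ := Metric.eventually_nhds_iff.mp h
  refine Metric.eventually_nhds_iff.mpr ⟨δ ^ 2, by positivity, fun t ht => ?_⟩
  obtain ⟨r, rfl⟩ := IsAlgClosed.exists_pow_nat_eq t (n := 2) (by norm_num)
  refine H ?_
  rw [dist_zero_right] at ht ⊢
  rw [norm_pow] at ht
  exact lt_of_pow_lt_pow_left₀ 2 hδ.le ht

end WhitneyA

open WhitneyA in
theorem mainTheorem10 {β : Type*} (D : Set (MvPolynomial (Fin 2) ℂ))
    (hD : ∀ f, WhitneyA.HasIsolatedSingularity f → f ∈ D) :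
    (¬ ∃ α : D → β, ∀ (F : MvPolynomial (Fin 3) ℂ) (hF : ∀ t, WhitneyA.slice F t ∈ D),
      WhitneyA.IsFamily F →
        ((∀ s t : ℂ, α ⟨WhitneyA.slice F s, hF s⟩ = α ⟨WhitneyA.slice F t, hF t⟩) ↔
          WhitneyA.IsARegular ℂ (WhitneyA.zeroLocus F \ WhitneyA.paramAxis)
            WhitneyA.paramAxis)) ∧
    (¬ ∃ α : D → β, ∀ (F : MvPolynomial (Fin 3) ℂ) (hF : ∀ t, WhitneyA.slice F t ∈ D),
      WhitneyA.IsFamily F →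
        ((∀ᶠ t in 𝓝 (0 : ℂ), α ⟨WhitneyA.slice F t, hF t⟩ = α ⟨WhitneyA.slice F 0, hF 0⟩) ↔
          WhitneyA.IsARegularAt ℂ (WhitneyA.zeroLocus F \ WhitneyA.paramAxis)
            WhitneyA.paramAxis 0)) := by
  have hF (k : ℕ) (t : ℂ) : slice (cubicFamily k) t ∈ D := by
    rw [slice_cubicFamily]
    exact hD _ (hasIsolatedSingularity_nodalCubic _)
  have hα (α : D → β) (t : ℂ) : α ⟨slice (cubicFamily 2) t, hF 2 t⟩ =
      α ⟨slice (cubicFamily 1) (t ^ 2), hF 1 (t ^ 2)⟩ :=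
    congrArg α (Subtype.ext (by simp [slice_cubicFamily]))
  refine ⟨?_, ?_⟩
  · rintro ⟨α, h⟩
    have h2 := (h _ (hF 2) (isFamily_cubicFamily two_ne_zero)).mpr
      fun y hy => isARegularAt_cubicFamily_two hy.1
    refine not_isARegular_cubicFamily_one
      ((h _ (hF 1) (isFamily_cubicFamily one_ne_zero)).mp fun s t => ?_)
    obtain ⟨s, rfl⟩ := IsAlgClosed.exists_pow_nat_eq s (n := 2) (by norm_num)
    obtain ⟨t, rfl⟩ := IsAlgClosed.exists_pow_nat_eq t (n := 2) (by norm_num)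
    rw [← hα α, ← hα α]
    exact h2 s t
  · rintro ⟨α, h⟩
    have h2 := (h _ (hF 2) (isFamily_cubicFamily two_ne_zero)).mpr
      (isARegularAt_cubicFamily_two (by simp [paramAxis]))
    refine not_isARegularAt_cubicFamily_one
      ((h _ (hF 1) (isFamily_cubicFamily one_ne_zero)).mp (eventually_of_eventually_sq ?_))
    filter_upwards [h2] with t ht
    rw [← hα α, ht, hα α]
    exact congrArg α (Subtype.ext (by simp))
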